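/- All graphs are finite, undirected, connected multigraphs without self-loops (multiple edges are allowed). Let $G$ be such a graph with vertices $0,\dots,n$, where $n\ge 0$, and let $Q(G)=D(G)-A(G)$ be its Laplacian matrix ($D(G)$ is the diagonal matrix of vertex degrees, and the entry $A(G)_{ij}$ is the number of edges joining $i$ and $j$). The rows $b_0,\dots,b_n$ of $Q(G)$ lie in the hyperplane $H_0=\{x\in\mathbb R^{n+1} : \sum_i x_i=0\}$; let $L_G\subset H_0$ be the lattice that they generate over $\mathbb Z$. For a permutation $\sigma$ of $\{0,\dots,n\}$ put $u^\sigma_k=\sum_{j=0}^{k} b_{\sigma(j)}$ for $0\le k\le n$, and let $\triangle_\sigma=\mathrm{conv}(u^\sigma_0,\dots,u^\sigma_n)$. Let $Del_G=\{\triangle_\sigma+p : \sigma\in S_{n+1},\ p\in L_G\}$ be the Delaunay triangulation of $L_G$ defined by $G$, and let the Delaunay polytope of the origin, $H_{Del_G}(O)$, be the union of those simplices in $Del_G$ that have the origin $O$ as a vertex. Two subsets $P_1,P_2$ of $H_0$ are called congruent if $P_2=M(P_1)$ for some isometry $M(x)=Ax+t$, where $A$ is an orthogonal transformation of $H_0$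 and $t\in H_0$. If $P_1$ and $P_2$ belong to graphs on different vertex sets, $M$ is an affine isometry from the hyperplane $H_0$ of the first graph onto that of the second (so there is none when the numbers of vertices differ). Theorem. Let $G_1$ and $G_2$ be finite undirected connected multigraphs without self-loops. Then: 1. For $G=G_1$ and for $G=G_2$, $H_{Del_G}(O)=\bigcup_{\sigma\in S_{n+1}}\triangle_\sigma$, where $n+1$ is the number of vertices of $G$. 2. $H_{Del_{G_1}}(O)$ and $H_{Del_{G_2}}(O)$ are congruent if and only if $G_1$ and $G_2$ are isomorphic. -/

import Mathlib

open scoped Graph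

noncomputable section

namespace LaplacianDelaunay

section Multigraph

variable {α β α' β' : Type*}

/-- A multigraph is connected if it has a vertex and any two of its vertices are joined by a
walk. -/
def IsConnected (G : Graph α β) : Prop :=
  V(G).Nonempty ∧ ∀ x ∈ V(G), ∀ y ∈ V(G), Relation.ReflTransGen G.Adj x y

/-- Isomorphism of multigraphs: a bijection of the vertices together with a bijection of the
edges that preserve and reflect incidence. -/
def Isomorphic (G : Graph α β) (G' : Graph α' β') : Prop :=
  ∃ (f : V(G) ≃ V(G')) (g : E(G) ≃ E(G')),
    ∀ (e : E(G)) (x y : V(G)), G.IsLink e x y ↔ G'.IsLink (g e) (f x) (f y)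

/-- The number of edges joining `x` and `y`. -/
def edgeMultiplicity (G : Graph α β) (x y : α) : ℕ := {e | G.IsLink e x y}.ncard

/-- The degree of a vertex of a multigraph without loops: the number of edges incident with it. -/
def degree (G : Graph α β) (x : α) : ℕ := (G.incidenceSet x).ncard

open Classical in
/-- The Laplacian matrix: the diagonal matrix of degrees minus the adjacency matrix. -/
def laplacian (G : Graph α β) : Matrix V(G) V(G) ℝ :=
  Matrix.diagonal (fun x : V(G) => (degree G x : ℝ)) -
    Matrix.of (fun x y : V(G) => (edgeMultiplicity G x y : ℝ))

end Multigraph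

section Polytope

/-- The hyperplane of vectors with coordinate sum zero in the Euclidean space `ℝ^V`. -/
def H₀ (V : Type*) [Fintype V] : Submodule ℝ (EuclideanSpace ℝ V) where
  carrier := {x | ∑ v, x v = 0}
  add_mem' := by
    intro a b ha hb
    simp only [Set.mem_ofPred_eq] at ha hb ⊢
    simp [Finset.sum_add_distrib, ha, hb]
  zero_mem' := by simp
  smul_mem' := by
    intro c a ha
    simp only [Set.mem_ofPred_eq] at ha ⊢
    simp [← Finset.mul_sum, ha]

/-- Two subsets of the hyperplanes `H₀ V` and `H₀ W` are congruent if some affine isometry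
of `H₀ V` onto `H₀ W` maps the first onto the second. For `V = W` these are the maps
`x ↦ A x + t` with `A` an orthogonal transformation of `H₀ V` and `t ∈ H₀ V`. -/
def Congruent {V W : Type*} [Fintype V] [Fintype W] (P : Set (H₀ V)) (P' : Set (H₀ W)) : Prop :=
  ∃ M : H₀ V ≃ᵃⁱ[ℝ] H₀ W, M '' P = P'

/-- For a family `T` of convex sets, the union of those that have the origin as a vertex
(a vertex of a polytope being an extreme point). -/
def originStar {E : Type*} [AddCommGroup E] [Module ℝ E] (T : Set (Set E)) : Set E :=
  ⋃₀ {K ∈ T | (0 : E) ∈ K.extremePoints ℝ}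

variable {α β : Type*}

theorem sum_laplacian (G : Graph α β) [Fintype V(G)] [Finite E(G)] [G.Loopless] (x : V(G)) :
    ∑ y, laplacian G x y = 0 := by
  classical
  have hfin : ∀ y : V(G), {e | G.IsLink e x y}.Finite := fun y =>
    (Set.toFinite E(G)).subset fun e he => Graph.IsLink.edge_mem he
  have hU : G.incidenceSet x = ⋃ y : V(G), {e | G.IsLink e x y} := by
    ext e
    simp only [Graph.incidenceSet, Set.mem_ofPred_eq, Set.mem_iUnion]
    exact ⟨fun ⟨y, hy⟩ => ⟨⟨y, hy.right_mem⟩, hy⟩, fun ⟨y, hy⟩ => ⟨y, hy⟩⟩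
  have hdeg : degree G x = ∑ y : V(G), edgeMultiplicity G x y := by
    unfold degree edgeMultiplicity
    rw [hU, Set.ncard_iUnion_of_finite hfin, finsum_eq_sum_of_fintype]
    intro y z hyz
    refine Set.disjoint_left.2 fun e hy hz => hyz ?_
    exact Subtype.ext (Graph.IsLink.right_unique hy hz)
  simp [laplacian, Matrix.diagonal_apply, hdeg]

variable (G : Graph α β) [Fintype V(G)] [Finite E(G)] [G.Loopless]

/-- The row `b_v` of the Laplacian matrix, a point of the hyperplane `H₀`. -/
def row (v : V(G)) : H₀ V(G) := ⟨WithLp.toLp 2 (laplacian G v), sum_laplacian G v⟩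

/-- The Laplacian lattice: the integral combinations of the rows of the Laplacian matrix. -/
def laplacianLattice : AddSubgroup (H₀ V(G)) := AddSubgroup.closure (Set.range (row G))

/-- The partial sum `u^σ_k = b_{σ 0} + ⋯ + b_{σ k}` for an ordering `σ` of the vertices. -/
def partialSum (σ : Fin (Fintype.card V(G)) ≃ V(G)) (k : Fin (Fintype.card V(G))) : H₀ V(G) :=
  ∑ j ∈ Finset.Iic k, row G (σ j)

/-- The simplex `conv(u^σ_0, …, u^σ_n)`, where `n + 1` is the number of vertices. -/
def simplex (σ : Fin (Fintype.card V(G)) ≃ V(G)) : Set (H₀ V(G)) :=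
  convexHull ℝ (Set.range (partialSum G σ))

/-- The Delaunay triangulation of the Laplacian lattice that is defined by `G`: all translates of
the simplices `simplex G σ` by lattice points. -/
def delaunayTriangulation : Set (Set (H₀ V(G))) :=
  {K | ∃ σ, ∃ p ∈ laplacianLattice G, K = (fun x => x + p) '' simplex G σ}

/-- The Delaunay polytope of the origin: the union of the simplices of the Delaunay triangulation
that have the origin as a vertex. -/
def delaunayPolytope : Set (H₀ V(G)) := originStar (delaunayTriangulation G)

end Polytope

end LaplacianDelaunay

end

/-! Part 1: a translate of a simplex with vertex `O` is translated by minus one of its vertices, and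
cyclically shifting the ordering shows that it is again some `simplex G τ`, because the rows sum to
zero. Conversely `O` is the last partial sum of every ordering, and it is extreme because some
linear functional is positive on all the other partial sums.

Part 2: the support function of the union is `u ↦ (∑ v, |⟪b_v, u⟫|) / 2`. It is even, so a
congruence cannot hide a translation, and its linear part carries one such sum to the other
(`sum_abs_inner_row_eq`). The kinks of the sum recover the rows up to sign and order; since the only
linear relation among the rows is the vanishing of their sum, the sign is common to all
(`FreelyPrescribable.exists_equiv`). Hence the Gram matrices `Q²` agree up to relabelling, so do
their positive semidefinite roots `Q`, and `Q` determines the graph. -/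

namespace LaplacianDelaunay

/-! ### The Laplacian quadratic form -/

section Laplacian

variable {α β : Type*} (G : Graph α β)

theorem edgeMultiplicity_comm (x y : α) : edgeMultiplicity G x y = edgeMultiplicity G y x := by
  simp only [edgeMultiplicity, G.isLink_comm]

theorem laplacian_comm (x y : V(G)) : laplacian G x y = laplacian G y x := by
  classical
  simp only [laplacian, Matrix.sub_apply, Matrix.diagonal_apply, Matrix.of_apply,
    edgeMultiplicity_comm G (x : α) y]
  by_cases h : x = y
  · subst h; rfl
  · simp [h, Ne.symm h]

theorem laplacian_of_ne {x y : V(G)} (h : x ≠ y) :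
    laplacian G x y = -(edgeMultiplicity G x y : ℝ) := by
  simp [laplacian, h]

variable [Fintype V(G)] [Finite E(G)] [G.Loopless]

/-- Expanding the square, the pure squares cancel because rows and columns sum to zero. The factor 2
counts each edge from both ends. -/
theorem two_mul_laplacian_quadratic (x : V(G) → ℝ) :
    2 * ∑ v : V(G), ∑ w : V(G), x v * laplacian G v w * x w =
      ∑ v : V(G), ∑ w : V(G), (edgeMultiplicity G v w : ℝ) * (x v - x w) ^ 2 := by
  have h1 : ∑ v : V(G), ∑ w : V(G), laplacian G v w * x v ^ 2 = 0 := by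
    simp [← Finset.sum_mul, sum_laplacian]
  have h2 : ∑ v : V(G), ∑ w : V(G), laplacian G v w * x w ^ 2 = 0 := by
    rw [Finset.sum_comm]
    simp_rw [laplacian_comm G]
    exact h1
  have h3 : ∀ v w : V(G), (edgeMultiplicity G v w : ℝ) * (x v - x w) ^ 2 =
      2 * (x v * laplacian G v w * x w) - laplacian G v w * x v ^ 2 -
        laplacian G v w * x w ^ 2 := by
    intro v w
    by_cases h : v = w
    · subst h; ring
    · rw [laplacian_of_ne G h]; ring
  simp_rw [h3, Finset.sum_sub_distrib, h1, h2, Finset.mul_sum]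
  ring

variable {G}

/-- A vanishing sum of nonnegative edge terms forces equality along every edge, hence along every
walk. -/
theorem eq_of_laplacian_quadratic_eq_zero (hG : IsConnected G) {x : V(G) → ℝ}
    (hx : ∑ v : V(G), ∑ w : V(G), x v * laplacian G v w * x w = 0) (v w : V(G)) : x v = x w := by
  have h := two_mul_laplacian_quadratic G x
  rw [hx, mul_zero, eq_comm, Finset.sum_eq_zero_iff_of_nonneg
    (fun v _ => Finset.sum_nonneg fun w _ => by positivity)] at h
  have hadj : ∀ v w : V(G), G.Adj v w → x v = x w := by
    intro v w hvw
    have h' := h v (Finset.mem_univ _)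
    rw [Finset.sum_eq_zero_iff_of_nonneg (fun w _ => by positivity)] at h'
    have h'' := h' w (Finset.mem_univ _)
    have hpos : 0 < edgeMultiplicity G v w := by
      have hfin : {e | G.IsLink e v w}.Finite :=
        (Set.toFinite E(G)).subset fun e he => Graph.IsLink.edge_mem he
      exact (Set.ncard_pos hfin).2 hvw
    have : (x v - x w) ^ 2 = 0 := by
      rcases mul_eq_zero.1 h'' with h0 | h0
      · exact absurd (by exact_mod_cast h0) hpos.ne'
      · exact h0
    exact sub_eq_zero.1 (pow_eq_zero_iff two_ne_zero |>.1 this)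
  have key : ∀ b, Relation.ReflTransGen G.Adj v b → ∀ hb : b ∈ V(G), x v = x ⟨b, hb⟩ := by
    intro b hb
    induction hb with
    | refl => intro _; rfl
    | tail _ hbc ih => intro hc; exact (ih hbc.left_mem).trans (hadj ⟨_, hbc.left_mem⟩ ⟨_, hc⟩ hbc)
  exact key w (hG.2 v v.2 w w.2) w.2

theorem laplacian_posSemidef : (laplacian G).PosSemidef := by
  classical
  refine Matrix.PosSemidef.of_dotProduct_mulVec_nonneg ?_ ?_
  · ext x y
    simp [laplacian_comm G x y]
  · intro x
    have h := two_mul_laplacian_quadratic G x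
    have h' : 0 ≤ ∑ v : V(G), ∑ w : V(G), (edgeMultiplicity G v w : ℝ) * (x v - x w) ^ 2 := by positivity
    have : star x ⬝ᵥ (laplacian G).mulVec x = ∑ v : V(G), ∑ w : V(G), x v * laplacian G v w * x w := by
      simp [dotProduct, Matrix.mulVec, Finset.mul_sum, mul_assoc]
    rw [this]
    linarith

end Laplacian

/-! ### Rows of the Laplacian as vectors of the hyperplane -/

section Row

variable {α β : Type*} {G : Graph α β} [Fintype V(G)] [Finite E(G)] [G.Loopless]

theorem sum_coord {V : Type*} [Fintype V] (x : H₀ V) : ∑ v, (x : EuclideanSpace ℝ V) v = 0 := x.2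

@[simp]
theorem row_apply (v w : V(G)) : (row G v : EuclideanSpace ℝ V(G)) w = laplacian G v w := rfl

theorem inner_row (v : V(G)) (x : H₀ V(G)) :
    inner ℝ (row G v) x = ∑ w, laplacian G v w * (x : EuclideanSpace ℝ V(G)) w := by
  simp [Submodule.coe_inner, PiLp.inner_apply, mul_comm]

theorem inner_row_row (v w : V(G)) :
    inner ℝ (row G v) (row G w) = (laplacian G * laplacian G) v w := by
  rw [inner_row, Matrix.mul_apply]
  exact Finset.sum_congr rfl fun u _ => by rw [row_apply, laplacian_comm G w u]

variable (G) in
theorem sum_row : ∑ v, row G v = 0 := by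
  ext w
  simp only [AddSubmonoidClass.coe_finsetSum, WithLp.ofLp_sum, Finset.sum_apply, row_apply,
    ZeroMemClass.coe_zero, PiLp.zero_apply]
  simp_rw [laplacian_comm G _ w, sum_laplacian]

/-- On a connected graph the rows of the Laplacian satisfy no relation besides the vanishing of
their sum: inner products with them can be prescribed freely, subject to having sum zero. -/
theorem exists_inner_row_eq (hG : IsConnected G) (y : V(G) → ℝ) (hy : ∑ v, y v = 0) :
    ∃ u : H₀ V(G), ∀ v, inner ℝ (row G v) u = y v := by
  -- `T` is the Laplacian acting on `H₀`. Its kernel consists of constant vectors of sum zero, so it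
  -- is injective, and surjective by finite dimension.
  let T : H₀ V(G) →ₗ[ℝ] H₀ V(G) :=
    { toFun := fun x => ∑ v, (x : EuclideanSpace ℝ V(G)) v • row G v
      map_add' := fun x z => by simp [add_smul, Finset.sum_add_distrib]
      map_smul' := fun c x => by simp [mul_smul, Finset.smul_sum] }
  have hT : ∀ x w, (T x : EuclideanSpace ℝ V(G)) w = inner ℝ (row G w) x := by
    intro x w
    rw [inner_row]
    simp only [T, LinearMap.coe_mk, AddHom.coe_mk, AddSubmonoidClass.coe_finsetSum,
      WithLp.ofLp_sum, Finset.sum_apply, Submodule.coe_smul, PiLp.smul_apply, row_apply,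
      smul_eq_mul]
    exact Finset.sum_congr rfl fun v _ => by rw [laplacian_comm G v w, mul_comm]
  have hinj : Function.Injective T := by
    rw [injective_iff_map_eq_zero]
    intro x hx
    have hconst : ∀ v w : V(G), (x : EuclideanSpace ℝ V(G)) v = (x : EuclideanSpace ℝ V(G)) w := by
      refine eq_of_laplacian_quadratic_eq_zero hG ?_
      refine Finset.sum_eq_zero fun v _ => ?_
      have := hT x v
      rw [hx, inner_row] at this
      simp_rw [mul_assoc, ← Finset.mul_sum]
      rw [← this]
      simp
    ext v
    have hs := sum_coord x
    rw [Finset.sum_congr rfl fun w _ => hconst w v, Finset.sum_const, Finset.card_univ,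
      smul_eq_zero] at hs
    rcases hs with hs | hs
    · have : Nonempty V(G) := ⟨v⟩
      exact absurd hs Fintype.card_ne_zero
    · simpa using hs
  obtain ⟨u, hu⟩ := LinearMap.injective_iff_surjective.1 hinj ⟨WithLp.toLp 2 y, hy⟩
  refine ⟨u, fun v => ?_⟩
  rw [← hT, hu]

end Row

/-! ### Recovering vectors from a sum of absolute values -/

section SumAbsInner

open Filter Topology

/-- The absolute value is affine near `a ≠ 0`, so only a kink at `a = 0` contributes. -/
theorem eventually_abs_second_difference (a s : ℝ) :
    ∀ᶠ t in 𝓝[>] (0 : ℝ),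
      |a + t * s| + |a - t * s| - 2 * |a| = t * (2 * if a = 0 then |s| else 0) := by
  by_cases ha : a = 0
  · filter_upwards [self_mem_nhdsWithin] with t ht
    have ht' : 0 < t := ht
    simp only [ha, zero_add, zero_sub, abs_neg, abs_mul, abs_of_pos ht', abs_zero, if_true]
    ring
  · have hlim : Tendsto (fun t : ℝ => |t * s|) (𝓝[>] 0) (𝓝 0) := by
      have : Tendsto (fun t : ℝ => |t * s|) (𝓝 0) (𝓝 |0 * s|) :=
        Continuous.tendsto (by fun_prop) 0
      rw [zero_mul, abs_zero] at this
      exact this.mono_left nhdsWithin_le_nhds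
    filter_upwards [hlim.eventually (gt_mem_nhds (abs_pos.2 ha))] with t ht
    rw [if_neg ha]
    have h1 := abs_lt.1 ht
    rcases abs_cases a with h | h
    · rw [abs_of_nonneg (by linarith : 0 ≤ a + t * s), abs_of_nonneg (by linarith : 0 ≤ a - t * s)]
      linarith
    · rw [abs_of_nonpos (by linarith : a + t * s ≤ 0), abs_of_nonpos (by linarith : a - t * s ≤ 0)]
      linarith

variable {V W E : Type*} [Fintype V] [Fintype W] [NormedAddCommGroup E] [InnerProductSpace ℝ E]
  {b : V → E} {c : W → E}

/-- Second differences at `u` in direction `k` isolate the members orthogonal to `u`. -/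
theorem sum_abs_inner_on_zeros
    (h : ∀ u, ∑ v, |(inner ℝ (b v) u : ℝ)| = ∑ w, |(inner ℝ (c w) u : ℝ)|) (u k : E) :
    (∑ v, if (inner ℝ (b v) u : ℝ) = 0 then |(inner ℝ (b v) k : ℝ)| else 0) =
      ∑ w, if (inner ℝ (c w) u : ℝ) = 0 then |(inner ℝ (c w) k : ℝ)| else 0 := by
  have hb := eventually_all.2 fun v =>
    eventually_abs_second_difference (inner ℝ (b v) u) (inner ℝ (b v) k)
  have hc := eventually_all.2 fun w =>
    eventually_abs_second_difference (inner ℝ (c w) u) (inner ℝ (c w) k)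
  obtain ⟨t, ⟨hbt, hct⟩, ht⟩ := ((hb.and hc).and self_mem_nhdsWithin).exists
  have ht' : (0 : ℝ) < t := ht
  have hb' := Finset.sum_congr rfl fun v (_ : v ∈ Finset.univ) => hbt v
  have hc' := Finset.sum_congr rfl fun w (_ : w ∈ Finset.univ) => hct w
  have h1 := h (u + t • k)
  have h2 := h (u - t • k)
  have h3 := h u
  simp only [inner_add_right, inner_sub_right, inner_smul_right] at h1 h2
  simp only [Finset.sum_sub_distrib, Finset.sum_add_distrib, ← Finset.mul_sum] at hb' hc'
  rw [h1, h2, h3, hc'] at hb'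
  have := mul_left_cancel₀ ht'.ne' hb'
  linarith

/-- Testing on `a` and `d` gives the equality case of Cauchy–Schwarz with equal norms. -/
theorem eq_or_eq_neg_of_abs_inner_eq {a d : E}
    (h : ∀ u, |(inner ℝ a u : ℝ)| = |(inner ℝ d u : ℝ)|) : a = d ∨ a = -d := by
  have h1 := h a
  have h2 := h d
  rw [real_inner_self_eq_norm_sq, abs_of_nonneg (sq_nonneg _), real_inner_comm] at h1
  rw [real_inner_self_eq_norm_sq, abs_of_nonneg (sq_nonneg ‖d‖)] at h2
  rcases abs_cases (inner ℝ a d : ℝ) with h3 | h3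
  · left
    have : ‖a - d‖ ^ 2 = 0 := by rw [norm_sub_sq_real]; linarith
    simpa [sub_eq_zero] using this
  · right
    have : ‖a + d‖ ^ 2 = 0 := by rw [norm_add_sq_real]; linarith
    exact eq_neg_of_add_eq_zero_left (by simpa using this)

/-- The inner products of a vector with the family `b` can be any numbers whose sum is zero. -/
def FreelyPrescribable (b : V → E) : Prop :=
  ∀ y : V → ℝ, ∑ v, y v = 0 → ∃ u, ∀ v, inner ℝ (b v) u = y v

theorem FreelyPrescribable.eq_of_sum_smul_eq_zero (hb : FreelyPrescribable b) {a : V → ℝ}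
    (ha : ∑ v, a v • b v = 0) (x y : V) : a x = a y := by
  classical
  obtain ⟨u, hu⟩ := hb (Pi.single x 1 - Pi.single y 1) (by simp)
  have := congrArg (fun z => (inner ℝ z u : ℝ)) ha
  simp only [sum_inner, inner_smul_left, hu, inner_zero_left] at this
  simp [mul_sub, Finset.sum_sub_distrib, Pi.single_apply] at this
  linarith

theorem FreelyPrescribable.exists_inner_eq_single_sub_single [DecidableEq V]
    (hb : FreelyPrescribable b) (x y : V) :
    ∃ u, ∀ v, inner ℝ (b v) u = (Pi.single x 1 - Pi.single y 1 : V → ℝ) v :=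
  hb _ (by simp)

theorem exists_ne_ne_of_two_lt_card (hV : 2 < Fintype.card V) (x y : V) : ∃ z, z ≠ x ∧ z ≠ y := by
  classical
  have : ({x, y} : Finset V).card < Fintype.card V := (Finset.card_le_two).trans_lt hV
  obtain ⟨z, hz⟩ := Finset.exists_mem_notMem_of_card_lt_card (s := {x, y}) (t := Finset.univ)
    (by simpa using this)
  exact ⟨z, by simpa using hz⟩

theorem FreelyPrescribable.exists_inner_eq_zero_iff (hb : FreelyPrescribable b)
    (hV : 2 < Fintype.card V) (x : V) : ∃ u, ∀ v, (inner ℝ (b v) u : ℝ) = 0 ↔ v = x := by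
  classical
  obtain ⟨z, hzx, -⟩ := exists_ne_ne_of_two_lt_card hV x x
  -- The values are 0 at `x`, 1 elsewhere, and `2 - card V` at `z` to balance the sum; the last is
  -- nonzero because `card V > 2`.
  obtain ⟨u, hu⟩ := hb (fun v => 1 - (if v = x then 1 else 0) -
      (if v = z then (Fintype.card V - 1 : ℝ) else 0)) (by simp)
  refine ⟨u, fun v => ?_⟩
  rw [hu]
  have hV' : (2 : ℝ) < Fintype.card V := by exact_mod_cast hV
  by_cases hvx : v = x
  · subst hvx; simp [hzx.symm]
  · by_cases hvz : v = z
    · simp only [hvz, hzx, if_true, if_false, iff_false]; intro h; linarith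
    · simp [hvx, hvz]

/-- With `u` orthogonal to `b x` alone, `|⟪b x, ·⟫|` is the sum of `|⟪c w, ·⟫|` over the `c w`
orthogonal to `u`. Each of these vanishes wherever `b x` does, and no two members of `c` can do so
when there are at least three; hence the sum has exactly one term. -/
theorem FreelyPrescribable.exists_eq_or_eq_neg (hb : FreelyPrescribable b)
    (hc : FreelyPrescribable c) (hV : 2 < Fintype.card V) (hW : 2 < Fintype.card W)
    (h : ∀ u, ∑ v, |(inner ℝ (b v) u : ℝ)| = ∑ w, |(inner ℝ (c w) u : ℝ)|) (x : V) :
    ∃ w, b x = c w ∨ b x = -c w := by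
  classical
  obtain ⟨u, hu⟩ := hb.exists_inner_eq_zero_iff hV x
  have key : ∀ k, |(inner ℝ (b x) k : ℝ)| =
      ∑ w, if (inner ℝ (c w) u : ℝ) = 0 then |(inner ℝ (c w) k : ℝ)| else 0 := by
    intro k
    rw [← sum_abs_inner_on_zeros h u k]
    simp [hu]
  have hzero : ∀ k, (inner ℝ (b x) k : ℝ) = 0 → ∀ w, (inner ℝ (c w) u : ℝ) = 0 →
      (inner ℝ (c w) k : ℝ) = 0 := by
    intro k hk w hw
    have := key k
    rw [hk, abs_zero, eq_comm, Finset.sum_eq_zero_iff_of_nonneg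
      (fun w _ => by split_ifs <;> positivity)] at this
    simpa [hw] using this w (Finset.mem_univ _)
  have hex : ∃ w, (inner ℝ (c w) u : ℝ) = 0 := by
    by_contra! hne
    obtain ⟨y, hy, -⟩ := exists_ne_ne_of_two_lt_card hV x x
    obtain ⟨k, hk⟩ := hb.exists_inner_eq_single_sub_single x y
    have := key k
    simp [hne, hk, hy.symm] at this
  obtain ⟨w, hw⟩ := hex
  have huniq : ∀ w', (inner ℝ (c w') u : ℝ) = 0 → w' = w := by
    intro w' hw'
    by_contra hne
    obtain ⟨z, hzw, hzw'⟩ := exists_ne_ne_of_two_lt_card hW w w'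
    obtain ⟨k₁, hk₁⟩ := hc.exists_inner_eq_single_sub_single w z
    obtain ⟨k₂, hk₂⟩ := hc.exists_inner_eq_single_sub_single w' z
    have h2 : (inner ℝ (b x) k₂ : ℝ) = 0 := by
      -- This combination is orthogonal to `b x`, and its product with `c w` is `⟪b x, k₂⟫`.
      have := hzero ((inner ℝ (b x) k₂ : ℝ) • k₁ - (inner ℝ (b x) k₁ : ℝ) • k₂)
        (by simp only [inner_sub_right, inner_smul_right]; ring) w hw
      simpa [inner_sub_right, inner_smul_right, hk₁, hk₂, hzw, hzw.symm, hne, Ne.symm hne]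
        using this
    have := hzero k₂ h2 w' hw'
    simp [hk₂, hzw'.symm] at this
  refine ⟨w, eq_or_eq_neg_of_abs_inner_eq fun k => ?_⟩
  rw [key k, Finset.sum_eq_single w (fun w' _ hne => if_neg fun h0 => hne (huniq w' h0))
    (by simp), if_pos hw]

theorem FreelyPrescribable.injective_up_to_sign (hb : FreelyPrescribable b)
    (hV : 2 < Fintype.card V) {x y : V} (h : b x = b y ∨ b x = -b y) : x = y := by
  obtain ⟨u, hu⟩ := hb.exists_inner_eq_zero_iff hV y
  rw [← hu x]
  have := (hu y).2 rfl
  rcases h with h | h <;> simp [h, this]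

omit [InnerProductSpace ℝ E] in
theorem eq_neg_of_sum_eq_zero_of_card_le_two (hV : Fintype.card V ≤ 2) (hb : ∑ v, b v = 0)
    {x y : V} (hxy : x ≠ y) : b x = -b y := by
  classical
  have huniv : ({x, y} : Finset V) = Finset.univ :=
    Finset.eq_univ_of_card _ (le_antisymm (Finset.card_le_univ _)
      (by rw [Finset.card_pair hxy]; exact hV))
  rw [← huniv, Finset.sum_pair hxy] at hb
  exact eq_neg_of_add_eq_zero_left hb

theorem sum_abs_inner_eq_card_mul (hV : Fintype.card V ≤ 2) (hb : ∑ v, b v = 0) (x : V) (u : E) :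
    ∑ v, |(inner ℝ (b v) u : ℝ)| = Fintype.card V * |(inner ℝ (b x) u : ℝ)| := by
  have : ∀ v, |(inner ℝ (b v) u : ℝ)| = |(inner ℝ (b x) u : ℝ)| := by
    intro v
    rcases eq_or_ne v x with rfl | hvx
    · rfl
    · rw [eq_neg_of_sum_eq_zero_of_card_le_two hV hb hvx, inner_neg_left, abs_neg]
  simp [this]

/-- Two families with freely prescribable inner products, each of sum zero, are determined up to a
common sign and a bijection of the indices by the sum of the absolute values of the inner products
with their members. -/
theorem FreelyPrescribable.exists_equiv (hb : FreelyPrescribable b) (hc : FreelyPrescribable c)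
    (hb0 : ∑ v, b v = 0) (hc0 : ∑ w, c w = 0) (hVW : Fintype.card V = Fintype.card W)
    (h : ∀ u, ∑ v, |(inner ℝ (b v) u : ℝ)| = ∑ w, |(inner ℝ (c w) u : ℝ)|) :
    ∃ (f : V ≃ W) (ε : ℝ), ε ^ 2 = 1 ∧ ∀ v, b v = ε • c (f v) := by
  classical
  rcases lt_or_ge 2 (Fintype.card V) with hV | hV
  · have hex : ∀ x, ∃ w, ∃ ε : ℝ, ε ^ 2 = 1 ∧ b x = ε • c w := by
      intro x
      obtain ⟨w, hw | hw⟩ := hb.exists_eq_or_eq_neg hc hV (hVW ▸ hV) h x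
      · exact ⟨w, 1, by norm_num, by simpa using hw⟩
      · exact ⟨w, -1, by norm_num, by simpa using hw⟩
    choose f ε hε hf using hex
    have hinj : Function.Injective f := by
      intro x y hxy
      refine hb.injective_up_to_sign hV ?_
      rw [hf x, hf y, hxy]
      rcases mul_self_eq_one_iff.1 ((sq _).symm.trans (hε x)) with h1 | h1 <;>
        rcases mul_self_eq_one_iff.1 ((sq _).symm.trans (hε y)) with h2 | h2 <;> simp [h1, h2]
    let F : V ≃ W := Equiv.ofBijective f
      ((Fintype.bijective_iff_injective_and_card f).2 ⟨hinj, hVW⟩)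
    -- The signs are the coefficients of a linear relation among the `c w`, so they are all equal.
    have hrel : ∑ w, ε (F.symm w) • c w = 0 := by
      rw [← hb0, ← F.sum_comp]
      exact Finset.sum_congr rfl fun v _ => by rw [F.symm_apply_apply, hf v]; rfl
    have hconst := hc.eq_of_sum_smul_eq_zero hrel
    obtain ⟨v₀⟩ : Nonempty V := Fintype.card_pos_iff.1 (by omega)
    refine ⟨F, ε v₀, hε v₀, fun v => ?_⟩
    have := hconst (F v) (F v₀)
    rw [F.symm_apply_apply, F.symm_apply_apply] at this
    rw [← this, hf v]
    rfl
  -- With at most two members no single one can be isolated, but they agree up to sign, so any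
  -- bijection serves.
  · have e : V ≃ W := Fintype.equivOfCardEq hVW
    rcases isEmpty_or_nonempty V with hE | ⟨⟨x⟩⟩
    · exact ⟨e, 1, by norm_num, fun v => hE.elim v⟩
    have hx : ∃ ε : ℝ, ε ^ 2 = 1 ∧ b x = ε • c (e x) := by
      have : b x = c (e x) ∨ b x = -c (e x) := by
        refine eq_or_eq_neg_of_abs_inner_eq fun u => ?_
        have hu := h u
        rw [sum_abs_inner_eq_card_mul hV hb0 x, sum_abs_inner_eq_card_mul (hVW ▸ hV) hc0 (e x),
          ← hVW] at hu
        exact mul_left_cancel₀ (by exact_mod_cast (Fintype.card_pos_iff.2 ⟨x⟩).ne') hu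
      rcases this with hx | hx
      · exact ⟨1, by norm_num, by simpa using hx⟩
      · exact ⟨-1, by norm_num, by simpa using hx⟩
    obtain ⟨ε, hε, hx⟩ := hx
    refine ⟨e, ε, hε, fun v => ?_⟩
    rcases eq_or_ne v x with rfl | hvx
    · exact hx
    · rw [eq_neg_of_sum_eq_zero_of_card_le_two hV hb0 hvx,
        eq_neg_of_sum_eq_zero_of_card_le_two (hVW ▸ hV) hc0 (e.injective.ne hvx), hx, smul_neg]

end SumAbsInner

/-! ### From the Gram matrix of the rows to the graph -/

section Isomorphism

variable {α β α' β' : Type*} {G : Graph α β} {G' : Graph α' β'}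

/-- The unordered pair of ends of an edge. -/
noncomputable def ends (G : Graph α β) (e : E(G)) : Sym2 V(G) :=
  s(⟨_, (G.exists_isLink_of_mem_edgeSet e.2).choose_spec.choose_spec.left_mem⟩,
    ⟨_, (G.exists_isLink_of_mem_edgeSet e.2).choose_spec.choose_spec.right_mem⟩)

theorem ends_eq_iff (e : E(G)) (x y : V(G)) : ends G e = s(x, y) ↔ G.IsLink e x y := by
  have h := (G.exists_isLink_of_mem_edgeSet e.2).choose_spec.choose_spec
  rw [h.isLink_iff]
  simp [ends, Subtype.ext_iff]

theorem card_ends_fiber (x y : V(G)) :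
    Nat.card {e : E(G) // ends G e = s(x, y)} = edgeMultiplicity G x y := by
  rw [edgeMultiplicity, ← Nat.card_coe_set_eq]
  refine Nat.card_congr
    { toFun := fun e => ⟨e.1, (ends_eq_iff _ _ _).1 e.2⟩
      invFun := fun e => ⟨⟨e.1, Graph.IsLink.edge_mem e.2⟩, (ends_eq_iff _ _ _).2 e.2⟩
      left_inv := fun e => rfl
      right_inv := fun e => rfl }

/-- Edges are fibred over their pairs of ends; equinumerous fibres glue to a bijection of edges. -/
theorem isomorphic_of_edgeMultiplicity_eq [Finite E(G)] [Finite E(G')] (f : V(G) ≃ V(G'))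
    (h : ∀ x y : V(G), edgeMultiplicity G x y = edgeMultiplicity G' (f x) (f y)) :
    Isomorphic G G' := by
  have hfib : ∀ s : Sym2 V(G'), Nonempty
      ({e : E(G) // (ends G e).map f = s} ≃ {e : E(G') // ends G' e = s}) := by
    intro s
    have hs : ∀ e : E(G), (ends G e).map f = s ↔ ends G e = s.map f.symm := by
      intro e
      constructor
      · rintro rfl; simp [Sym2.map_map]
      · intro he; simp [he, Sym2.map_map]
    refine ⟨(Equiv.subtypeEquivRight hs).trans (Finite.card_eq.1 ?_).some⟩
    induction s using Sym2.ind with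
    | _ x y => rw [Sym2.map_mk, card_ends_fiber, card_ends_fiber, h]; simp
  let g : E(G) ≃ E(G') := Equiv.ofFiberEquiv fun s => (hfib s).some
  have hg : ∀ e, ends G' (g e) = (ends G e).map f := fun e => Equiv.ofFiberEquiv_map _ e
  refine ⟨f, g, fun e x y => ?_⟩
  rw [← ends_eq_iff, ← ends_eq_iff, hg, ← Sym2.map_mk]
  exact (Sym2.map.injective f.injective).eq_iff.symm

theorem Isomorphic.exists_edgeMultiplicity_eq (h : Isomorphic G G') :
    ∃ f : V(G) ≃ V(G'),
      ∀ x y : V(G), edgeMultiplicity G x y = edgeMultiplicity G' (f x) (f y) := by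
  obtain ⟨f, g, hfg⟩ := h
  refine ⟨f, fun x y => ?_⟩
  rw [← card_ends_fiber, ← card_ends_fiber]
  exact Nat.card_congr (g.subtypeEquiv fun e => by rw [ends_eq_iff, ends_eq_iff, hfg])

variable [Fintype V(G)] [Fintype V(G')] [Finite E(G)] [Finite E(G')] [G.Loopless] [G'.Loopless]

theorem edgeMultiplicity_self (G : Graph α β) [G.Loopless] (x : α) :
    edgeMultiplicity G x x = 0 := by
  simp [edgeMultiplicity]

theorem laplacian_self (x : V(G)) :
    laplacian G x x = ∑ y : V(G), (edgeMultiplicity G x y : ℝ) := by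
  classical
  have h := sum_laplacian G x
  rw [← Finset.add_sum_erase _ _ (Finset.mem_univ x)] at h
  rw [← Finset.add_sum_erase _ _ (Finset.mem_univ x), edgeMultiplicity_self,
    eq_neg_of_add_eq_zero_left h, ← Finset.sum_neg_distrib]
  rw [Nat.cast_zero, zero_add]
  exact Finset.sum_congr rfl fun y hy => by
    rw [laplacian_of_ne G (Finset.ne_of_mem_erase hy).symm, neg_neg]

theorem laplacian_equiv_iff (f : V(G) ≃ V(G')) :
    (∀ x y, laplacian G' (f x) (f y) = laplacian G x y) ↔
      ∀ x y : V(G), edgeMultiplicity G x y = edgeMultiplicity G' (f x) (f y) := by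
  constructor
  · intro h x y
    by_cases hxy : x = y
    · subst hxy; simp [edgeMultiplicity_self]
    · have := h x y
      rw [laplacian_of_ne G hxy, laplacian_of_ne G' (f.injective.ne hxy), neg_inj] at this
      exact_mod_cast this.symm
  · intro h x y
    by_cases hxy : x = y
    · subst hxy
      rw [laplacian_self, laplacian_self, ← f.sum_comp]
      exact Finset.sum_congr rfl fun y _ => by rw [h]
    · rw [laplacian_of_ne G hxy, laplacian_of_ne G' (f.injective.ne hxy), h]

open scoped MatrixOrder Matrix.Norms.L2Operator in
theorem posSemidef_eq_of_mul_self_eq {n : Type*} [Fintype n] {A B : Matrix n n ℝ}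
    (hA : A.PosSemidef) (hB : B.PosSemidef) (h : A * A = B * B) : A = B := by
  classical
  rw [← CFC.sqrt_mul_self A hA.nonneg, h, CFC.sqrt_mul_self B hB.nonneg]

/-- By symmetry of `Q` the Gram matrix of the rows is `Q²`, whose positive semidefinite square root
is unique. -/
theorem isomorphic_of_inner_row_eq (f : V(G) ≃ V(G'))
    (h : ∀ x y, (inner ℝ (row G x) (row G y) : ℝ) = inner ℝ (row G' (f x)) (row G' (f y))) :
    Isomorphic G G' := by
  refine isomorphic_of_edgeMultiplicity_eq f ((laplacian_equiv_iff f).1 fun x y => ?_)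
  have hsq : laplacian G * laplacian G =
      (laplacian G').submatrix f f * (laplacian G').submatrix f f := by
    ext x y
    rw [← inner_row_row, h, inner_row_row, Matrix.submatrix_mul_equiv]
    rfl
  rw [posSemidef_eq_of_mul_self_eq laplacian_posSemidef
    (laplacian_posSemidef.submatrix f) hsq]
  rfl

end Isomorphism

/-! ### The support function of the union of simplices -/

section SupportFunction

variable {α β : Type*} {G : Graph α β} [Fintype V(G)] [Finite E(G)] [G.Loopless]

theorem inner_partialSum (σ : Fin (Fintype.card V(G)) ≃ V(G)) (k : Fin (Fintype.card V(G)))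
    (u : H₀ V(G)) :
    (inner ℝ (partialSum G σ k) u : ℝ) = ∑ j ∈ Finset.Iic k, inner ℝ (row G (σ j)) u := by
  rw [partialSum, sum_inner]

variable (G) in
theorem sum_inner_row (u : H₀ V(G)) : ∑ v, (inner ℝ (row G v) u : ℝ) = 0 := by
  rw [← sum_inner, sum_row, inner_zero_left]

theorem inner_le_of_mem_iUnion_simplex {x : H₀ V(G)} (hx : x ∈ ⋃ σ, simplex G σ) (u : H₀ V(G)) :
    (inner ℝ x u : ℝ) ≤ (∑ v, |(inner ℝ (row G v) u : ℝ)|) / 2 := by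
  obtain ⟨σ, hσ⟩ := Set.mem_iUnion.1 hx
  have hconv : Convex ℝ {x : H₀ V(G) | (inner ℝ x u : ℝ) ≤
      (∑ v, |(inner ℝ (row G v) u : ℝ)|) / 2} :=
    convex_halfSpace_le ⟨fun x y => inner_add_left x y u, fun c x => real_inner_smul_left x u c⟩ _
  refine convexHull_min ?_ hconv hσ
  rintro _ ⟨k, rfl⟩
  have h0 := sum_inner_row G u
  rw [Set.mem_ofPred_eq, inner_partialSum]
  -- Each term is at most its positive part `(|t| + t) / 2`; the linear halves cancel over all
  -- vertices.
  calc ∑ j ∈ Finset.Iic k, (inner ℝ (row G (σ j)) u : ℝ)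
      ≤ ∑ j ∈ Finset.Iic k, (|(inner ℝ (row G (σ j)) u : ℝ)| + inner ℝ (row G (σ j)) u) / 2 :=
        Finset.sum_le_sum fun j _ => by linarith [le_abs_self (inner ℝ (row G (σ j)) u : ℝ)]
    _ ≤ ∑ j, (|(inner ℝ (row G (σ j)) u : ℝ)| + inner ℝ (row G (σ j)) u) / 2 :=
        Finset.sum_le_sum_of_subset_of_nonneg (Finset.subset_univ _) fun j _ _ => by
          linarith [neg_abs_le (inner ℝ (row G (σ j)) u : ℝ)]
    _ = ∑ v, (|(inner ℝ (row G v) u : ℝ)| + inner ℝ (row G v) u) / 2 :=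
        σ.sum_comp fun v => (|(inner ℝ (row G v) u : ℝ)| + inner ℝ (row G v) u) / 2
    _ = (∑ v, |(inner ℝ (row G v) u : ℝ)|) / 2 := by
        rw [← Finset.sum_div, Finset.sum_add_distrib, h0, add_zero]

/-- Order the vertices by decreasing inner product with `u`: the prefix of nonnegative values sums
to the total of the positive parts. -/
theorem exists_mem_iUnion_simplex_inner_eq [Nonempty V(G)] (u : H₀ V(G)) :
    ∃ x ∈ ⋃ σ, simplex G σ,
      (inner ℝ x u : ℝ) = (∑ v, |(inner ℝ (row G v) u : ℝ)|) / 2 := by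
  classical
  set y : V(G) → ℝ := fun v => inner ℝ (row G v) u with hy
  have h0 : ∑ v, y v = 0 := sum_inner_row G u
  let e := (Fintype.equivFin V(G)).symm
  let σ : Fin (Fintype.card V(G)) ≃ V(G) := (Tuple.sort fun i => -y (e i)).trans e
  have hσ : Antitone fun i => y (σ i) := by
    intro i j hij
    have := Tuple.monotone_sort (fun i => -y (e i)) hij
    exact neg_le_neg_iff.1 this
  have hne : (Finset.univ.filter fun i => 0 ≤ y (σ i)).Nonempty := by
    obtain ⟨v, -, hv⟩ := Finset.exists_le_of_sum_le (f := fun _ => (0 : ℝ)) (g := y)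
      (s := Finset.univ) Finset.univ_nonempty (by simp [h0])
    exact ⟨σ.symm v, by simpa using hv⟩
  let k := (Finset.univ.filter fun i => 0 ≤ y (σ i)).max' hne
  have hk : 0 ≤ y (σ k) := (Finset.mem_filter.1 (Finset.max'_mem _ hne)).2
  have hIic : Finset.Iic k = Finset.univ.filter fun i => 0 ≤ y (σ i) := by
    ext i
    simp only [Finset.mem_Iic, Finset.mem_filter, Finset.mem_univ, true_and]
    exact ⟨fun hi => hk.trans (hσ hi), fun hi => Finset.le_max' _ _ (by simpa using hi)⟩
  refine ⟨partialSum G σ k, Set.mem_iUnion.2 ⟨σ, subset_convexHull ℝ _ ⟨k, rfl⟩⟩, ?_⟩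
  rw [inner_partialSum, hIic, Finset.sum_filter]
  have h1 : ∀ i, (if 0 ≤ y (σ i) then y (σ i) else 0) = (|y (σ i)| + y (σ i)) / 2 := by
    intro i
    split_ifs with h
    · rw [abs_of_nonneg h]; ring
    · rw [abs_of_neg (not_le.1 h)]; ring
  calc ∑ i, (if 0 ≤ y (σ i) then y (σ i) else 0)
      = ∑ i, (|y (σ i)| + y (σ i)) / 2 := Finset.sum_congr rfl fun i _ => h1 i
    _ = ∑ v, (|y v| + y v) / 2 := σ.sum_comp fun v => (|y v| + y v) / 2
    _ = (∑ v, |y v|) / 2 := by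
        rw [← Finset.sum_div, Finset.sum_add_distrib, h0, add_zero]

end SupportFunction

/-! ### The star of the origin -/

section Star

variable {α β : Type*} {G : Graph α β} [Fintype V(G)] [Finite E(G)] [G.Loopless]

/-- An open half-space together with the origin on its boundary is convex and has the origin as an
extreme point. -/
theorem zero_mem_extremePoints_convexHull {E : Type*} [AddCommGroup E] [Module ℝ E] {s : Set E}
    (l : E →ₗ[ℝ] ℝ) (h0 : (0 : E) ∈ s) (hs : ∀ x ∈ s, 0 < l x ∨ x = 0) :
    (0 : E) ∈ (convexHull ℝ s).extremePoints ℝ := by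
  have hconv : Convex ℝ {x : E | 0 < l x ∨ x = 0} := by
    intro x hx z hz a c ha hc hac
    simp only [Set.mem_ofPred_eq, map_add, map_smul, smul_eq_mul] at hx hz ⊢
    rcases ha.eq_or_lt with rfl | ha
    · rw [zero_add] at hac; subst hac; simpa using hz
    rcases hc.eq_or_lt with rfl | hc
    · rw [add_zero] at hac; subst hac; simpa using hx
    rcases hx with hx | rfl <;> rcases hz with hz | rfl
    · left; positivity
    · left; rw [map_zero, mul_zero, add_zero]; positivity
    · left; rw [map_zero, mul_zero, zero_add]; positivity
    · right; simp
  have hsub : convexHull ℝ s ⊆ {x : E | 0 < l x ∨ x = 0} := convexHull_min hs hconv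
  rw [mem_extremePoints]
  refine ⟨subset_convexHull ℝ _ h0, fun x hx z hz h => ?_⟩
  obtain ⟨a, c, ha, hc, hac, h⟩ := h
  have hi := congrArg l h
  simp only [map_add, map_smul, smul_eq_mul, map_zero] at hi
  rcases hsub hx with hx | rfl <;> rcases hsub hz with hz | rfl
  · have := mul_pos ha hx; have := mul_pos hc hz; linarith
  · rw [map_zero, mul_zero, add_zero] at hi; exact absurd hi (mul_pos ha hx).ne'
  · rw [map_zero, mul_zero, zero_add] at hi; exact absurd hi (mul_pos hc hz).ne'
  · exact ⟨rfl, rfl⟩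

theorem zero_mem_extremePoints_simplex (hG : IsConnected G)
    (σ : Fin (Fintype.card V(G)) ≃ V(G)) : (0 : H₀ V(G)) ∈ (simplex G σ).extremePoints ℝ := by
  classical
  have : Nonempty V(G) := hG.1.to_subtype
  have : NeZero (Fintype.card V(G)) := ⟨Fintype.card_ne_zero⟩
  set m : Fin (Fintype.card V(G)) := ⊤ with hm
  have hlast : partialSum G σ m = 0 := by
    rw [partialSum, hm, Finset.Iic_top, σ.sum_comp (row G), sum_row]
  -- With value 1 on the first row and -1 on the last, every proper prefix has inner product 1. For
  -- a single vertex there is no proper prefix.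
  obtain ⟨u, hu⟩ := exists_inner_row_eq hG (Pi.single (σ ⊥) 1 - Pi.single (σ m) 1) (by simp)
  refine zero_mem_extremePoints_convexHull
    { toFun := fun x => inner ℝ x u
      map_add' := fun x y => inner_add_left x y u
      map_smul' := fun c x => real_inner_smul_left x u c } ⟨m, hlast⟩ ?_
  rintro _ ⟨k, rfl⟩
  by_cases hk : k = m
  · right; rw [hk, hlast]
  · left
    have hmk : ¬ m ≤ k := fun h => hk (top_le_iff.1 h)
    change 0 < (inner ℝ (partialSum G σ k) u : ℝ)
    rw [inner_partialSum]
    simp_rw [hu]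
    simp [Pi.single_apply, hmk]

/-- Partial sums of a cyclically shifted family of sum zero. -/
theorem exists_sum_Iic_add_eq {M : Type*} [AddCommGroup M] {N : ℕ} (f : Fin N → M)
    (hf : ∑ i, f i = 0) (k : Fin N) :
    ∃ c : Equiv.Perm (Fin N), ∀ j, ∑ i ∈ Finset.Iic j, f (c i) =
      ∑ i ∈ Finset.Iic (c j), f i - ∑ i ∈ Finset.Iic k, f i := by
  have : NeZero N := ⟨(k.pos).ne'⟩
  let s : ℕ → M := fun i => f (Fin.ofNat N i)
  let S : ℕ → M := fun m => ∑ i ∈ Finset.range m, s i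
  have hsum : ∀ (g : ℕ → M) (j : Fin N),
      ∑ i ∈ Finset.Iic j, g i = ∑ i ∈ Finset.range (j + 1), g i := by
    intro g j
    rw [Nat.range_succ_eq_Iic, ← Fin.map_valEmbedding_Iic, Finset.sum_map]
    rfl
  have hσ : ∀ j, ∑ i ∈ Finset.Iic j, f i = S (j + 1) := by
    intro j
    simp only [S, ← hsum]
    exact Finset.sum_congr rfl fun i _ => by simp [s]
  have hSN : S N = 0 := by
    simp only [S]
    rw [← hf, ← Fin.sum_univ_eq_sum_range]
    exact Finset.sum_congr rfl fun i _ => by simp [s]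
  -- The offset 1 makes the value at `j` the sum over `Iic j`; the period comes from the total being
  -- zero.
  have hS : Function.Periodic (fun m => S (m + 1)) N := by
    intro m
    change S (m + N + 1) = S (m + 1)
    rw [show m + N + 1 = N + (m + 1) by ring]
    change ∑ i ∈ Finset.range (N + (m + 1)), s i = _
    rw [Finset.sum_range_add, show ∑ i ∈ Finset.range N, s i = 0 from hSN, zero_add]
    refine Finset.sum_congr rfl fun i _ => ?_
    simp [s, Fin.ofNat]
  -- The shifted family starts just after position `k`.
  let c : Fin N := Fin.ofNat N (k + 1)
  refine ⟨Equiv.addRight c, fun j => ?_⟩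
  have h1 : ∑ i ∈ Finset.Iic j, f (i + c) = ∑ i ∈ Finset.range (j + 1), s (k + 1 + i) := by
    rw [← hsum fun i => s (k + 1 + i)]
    refine Finset.sum_congr rfl fun i _ => ?_
    have : i + c = Fin.ofNat N (k + 1 + i) := by
      ext
      simp [c, Fin.val_add, add_comm]
    simp [s, this]
  have h2 : ((j + c : Fin N) : ℕ) = (k + 1 + j) % N := by
    simp [c, Fin.val_add, add_comm]
  simp only [Equiv.coe_addRight]
  rw [h1, hσ, hσ, h2, hS.map_mod_nat (k + 1 + j), eq_sub_iff_add_eq, add_comm]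
  change ∑ i ∈ Finset.range _, _ + _ = ∑ i ∈ Finset.range _, _
  rw [add_assoc (k + 1 : ℕ)]
  exact (Finset.sum_range_add _ _ _).symm

/-- Cyclically shifting an ordering translates its simplex by a vertex. -/
theorem exists_range_partialSum_eq (σ : Fin (Fintype.card V(G)) ≃ V(G))
    (k : Fin (Fintype.card V(G))) :
    ∃ τ : Fin (Fintype.card V(G)) ≃ V(G),
      Set.range (partialSum G τ) = Set.range fun j => partialSum G σ j - partialSum G σ k := by
  obtain ⟨c, hc⟩ := exists_sum_Iic_add_eq (fun i => row G (σ i))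
    ((σ.sum_comp (row G)).trans (sum_row G)) k
  refine ⟨c.trans σ, ?_⟩
  rw [show partialSum G (c.trans σ) =
    (fun j => partialSum G σ j - partialSum G σ k) ∘ c from funext hc]
  exact EquivLike.range_comp _ c

theorem delaunayPolytope_eq_iUnion_simplex (hG : IsConnected G) :
    delaunayPolytope G = ⋃ σ, simplex G σ := by
  refine Set.Subset.antisymm ?_ ?_
  · rintro x ⟨K, ⟨⟨σ, p, -, rfl⟩, hK⟩, hx⟩
    have himage : (fun x => x + p) '' simplex G σ =
        convexHull ℝ (Set.range fun j => partialSum G σ j + p) := by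
      rw [show (fun x => x + p) = AffineEquiv.constVAdd ℝ (H₀ V(G)) p from
        funext fun x => add_comm x p]
      refine ((AffineEquiv.constVAdd ℝ (H₀ V(G)) p).toAffineMap.image_convexHull _).trans ?_
      rw [← Set.range_comp]
      exact congrArg (fun g => convexHull ℝ (Set.range g)) (funext fun j => add_comm _ _)
    rw [himage] at hK hx
    -- Extreme points of a hull are among its generators, so `p` is minus a partial sum.
    obtain ⟨k, hk⟩ := extremePoints_convexHull_subset hK
    obtain ⟨τ, hτ⟩ := exists_range_partialSum_eq σ k
    have hp : p = -partialSum G σ k := by rw [eq_neg_iff_add_eq_zero, add_comm]; exact hk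
    refine Set.mem_iUnion.2 ⟨τ, ?_⟩
    rw [simplex, hτ]
    simpa [hp, sub_eq_add_neg] using hx
  · refine Set.iUnion_subset fun σ => Set.subset_sUnion_of_mem ⟨⟨σ, 0, zero_mem _, ?_⟩,
      zero_mem_extremePoints_simplex hG σ⟩
    simp

end Star

/-! ### Congruence and isomorphism -/

section Congruence

theorem finrank_H₀_add_one (V : Type*) [Fintype V] [Nonempty V] :
    Module.finrank ℝ (H₀ V) + 1 = Fintype.card V := by
  classical
  let s : EuclideanSpace ℝ V →ₗ[ℝ] ℝ :=
    { toFun := fun x => ∑ v, x v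
      map_add' := fun x y => by simp [Finset.sum_add_distrib]
      map_smul' := fun c x => by simp [Finset.mul_sum] }
  have hker : LinearMap.ker s = H₀ V := by ext x; rfl
  have hsurj : Function.Surjective s := by
    obtain ⟨v⟩ := ‹Nonempty V›
    intro r
    exact ⟨EuclideanSpace.single v r, by simp [s]⟩
  have h := s.finrank_range_add_finrank_ker
  rw [hker, LinearMap.range_eq_top.2 hsurj, finrank_top, Module.finrank_self,
    finrank_euclideanSpace] at h
  omega

/-- Relabelling the coordinates. -/
noncomputable def H₀Congr {V W : Type*} [Fintype V] [Fintype W] (f : V ≃ W) : H₀ V ≃ₗᵢ[ℝ] H₀ W where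
  toLinearEquiv := (LinearIsometryEquiv.piLpCongrLeft 2 ℝ ℝ f).toLinearEquiv.ofSubmodules
    (H₀ V) (H₀ W) (by
      ext x
      rw [Submodule.map_equiv_eq_comap_symm, Submodule.mem_comap]
      change (LinearIsometryEquiv.piLpCongrLeft 2 ℝ ℝ f).symm x ∈ H₀ V ↔ _
      rw [LinearIsometryEquiv.piLpCongrLeft_symm]
      change ∑ v, x (f v) = 0 ↔ ∑ w, x w = 0
      rw [f.sum_comp fun w => x w])
  norm_map' x := (LinearIsometryEquiv.piLpCongrLeft 2 ℝ ℝ f).norm_map x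

theorem H₀Congr_apply {V W : Type*} [Fintype V] [Fintype W] (f : V ≃ W) (x : H₀ V) (w : W) :
    (H₀Congr f x : EuclideanSpace ℝ W) w = (x : EuclideanSpace ℝ V) (f.symm w) := rfl

variable {α β α' β' : Type*} {G : Graph α β} {G' : Graph α' β'}
  [Fintype V(G)] [Fintype V(G')] [Finite E(G)] [Finite E(G')] [G.Loopless] [G'.Loopless]

theorem H₀Congr_image_simplex {f : V(G) ≃ V(G')}
    (hf : ∀ x y, laplacian G' (f x) (f y) = laplacian G x y)
    (σ : Fin (Fintype.card V(G)) ≃ V(G)) :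
    H₀Congr f '' simplex G σ =
      simplex G' (Equiv.equivCongr (finCongr (Fintype.card_congr f)) f σ) := by
  have hrow : ∀ v, H₀Congr f (row G v) = row G' (f v) := by
    intro v
    ext w
    rw [H₀Congr_apply, row_apply, row_apply, ← hf, f.apply_symm_apply]
  have hsum : H₀Congr f ∘ partialSum G σ =
      partialSum G' (Equiv.equivCongr (finCongr (Fintype.card_congr f)) f σ) ∘
        finCongr (Fintype.card_congr f) := by
    funext k
    simp only [Function.comp_apply, partialSum, map_sum, hrow]
    exact Finset.sum_equiv (finCongr (Fintype.card_congr f)) (by simp) (by simp)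
  refine ((H₀Congr f).toLinearEquiv.toLinearMap.image_convexHull _).trans ?_
  rw [← Set.range_comp, simplex,
    ← EquivLike.range_comp (partialSum G' _) (finCongr (Fintype.card_congr f)), ← hsum]
  rfl

theorem congruent_of_isomorphic (h : Isomorphic G G') :
    Congruent (⋃ σ, simplex G σ) (⋃ σ, simplex G' σ) := by
  obtain ⟨f, hf⟩ := h.exists_edgeMultiplicity_eq
  refine ⟨(H₀Congr f).toAffineIsometryEquiv, ?_⟩
  rw [LinearIsometryEquiv.coe_toAffineIsometryEquiv, Set.image_iUnion]
  simp_rw [H₀Congr_image_simplex ((laplacian_equiv_iff f).2 hf)]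
  exact (Equiv.equivCongr (finCongr (Fintype.card_congr f)) f).surjective.iUnion_comp
    fun σ => simplex G' σ

theorem sum_abs_inner_row_eq [Nonempty V(G)] [Nonempty V(G')] (M : H₀ V(G) ≃ᵃⁱ[ℝ] H₀ V(G'))
    (hM : M '' (⋃ σ, simplex G σ) = ⋃ σ, simplex G' σ) (u : H₀ V(G)) :
    ∑ v, |(inner ℝ (row G v) u : ℝ)| =
      ∑ w, |(inner ℝ (row G' w) (M.linearIsometryEquiv u) : ℝ)| := by
  set A := M.linearIsometryEquiv with hA
  have hMx : ∀ x, M x = A x + M 0 := by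
    intro x
    simpa using M.map_vadd 0 x
  have hinner : ∀ x u, (inner ℝ (M x) (A u) : ℝ) = inner ℝ x u + inner ℝ (M 0) (A u) := by
    intro x u
    rw [hMx, inner_add_left, A.inner_map_map]
  have h1 : ∀ u, (∑ v, |(inner ℝ (row G v) u : ℝ)|) / 2 + inner ℝ (M 0) (A u) ≤
      (∑ w, |(inner ℝ (row G' w) (A u) : ℝ)|) / 2 := by
    intro u
    obtain ⟨x, hx, hxu⟩ := exists_mem_iUnion_simplex_inner_eq u
    rw [← hxu, ← hinner]
    exact inner_le_of_mem_iUnion_simplex (hM ▸ Set.mem_image_of_mem M hx) _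
  have h2 : ∀ u, (∑ w, |(inner ℝ (row G' w) (A u) : ℝ)|) / 2 ≤
      (∑ v, |(inner ℝ (row G v) u : ℝ)|) / 2 + inner ℝ (M 0) (A u) := by
    intro u
    obtain ⟨x', hx', hxu⟩ := exists_mem_iUnion_simplex_inner_eq (A u)
    rw [← hM] at hx'
    obtain ⟨x, hx, rfl⟩ := hx'
    rw [← hxu, hinner]
    linarith [inner_le_of_mem_iUnion_simplex hx u]
  -- The sums are even in `u` and the translation term is odd, so comparing `u` with `-u` removes
  -- it.
  have h3 := h1 u
  have h4 := h1 (-u)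
  have h5 := h2 u
  have h6 := h2 (-u)
  simp only [map_neg, inner_neg_right, abs_neg] at h4 h6
  linarith

theorem isomorphic_of_congruent (hG : IsConnected G) (hG' : IsConnected G')
    (h : Congruent (⋃ σ, simplex G σ) (⋃ σ, simplex G' σ)) : Isomorphic G G' := by
  obtain ⟨M, hM⟩ := h
  have : Nonempty V(G) := hG.1.to_subtype
  have : Nonempty V(G') := hG'.1.to_subtype
  let A := M.linearIsometryEquiv
  have hA : ∀ x u, (inner ℝ (A.symm x) u : ℝ) = inner ℝ x (A u) := by
    intro x u
    rw [← A.inner_map_map, A.apply_symm_apply]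
  have hcard : Fintype.card V(G) = Fintype.card V(G') := by
    rw [← finrank_H₀_add_one, ← finrank_H₀_add_one, A.toLinearEquiv.finrank_eq]
  have hb : FreelyPrescribable (row G) := exists_inner_row_eq hG
  -- The rows of `G'` are pulled back to the hyperplane of `G`, so that both families lie in one
  -- space.
  have hc : FreelyPrescribable fun w => A.symm (row G' w) := by
    intro y hy
    obtain ⟨u, hu⟩ := exists_inner_row_eq hG' y hy
    exact ⟨A.symm u, fun w => by rw [A.symm.inner_map_map, hu]⟩
  obtain ⟨f, ε, hε, hf⟩ := hb.exists_equiv hc (sum_row G)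
    (by rw [← map_sum, sum_row, map_zero]) hcard fun u => by
      simp_rw [hA]
      exact sum_abs_inner_row_eq M hM u
  refine isomorphic_of_inner_row_eq f fun x y => ?_
  rw [hf x, hf y]
  refine (real_inner_smul_left _ _ _).trans ?_
  refine (congrArg (fun r => ε * r) (real_inner_smul_right _ _ _)).trans ?_
  rw [A.symm.inner_map_map, ← mul_assoc, ← sq, hε, one_mul]

end Congruence

end LaplacianDelaunay

theorem mainTheorem1 {α₁ β₁ α₂ β₂ : Type*} (G₁ : Graph α₁ β₁) (G₂ : Graph α₂ β₂)
    [Fintype V(G₁)] [Finite E(G₁)] [G₁.Loopless]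
    [Fintype V(G₂)] [Finite E(G₂)] [G₂.Loopless]
    (h₁ : LaplacianDelaunay.IsConnected G₁) (h₂ : LaplacianDelaunay.IsConnected G₂) :
    (LaplacianDelaunay.delaunayPolytope G₁ = ⋃ σ, LaplacianDelaunay.simplex G₁ σ) ∧
    (LaplacianDelaunay.delaunayPolytope G₂ = ⋃ σ, LaplacianDelaunay.simplex G₂ σ) ∧
    (LaplacianDelaunay.Congruent (LaplacianDelaunay.delaunayPolytope G₁)
        (LaplacianDelaunay.delaunayPolytope G₂) ↔
      LaplacianDelaunay.Isomorphic G₁ G₂) := by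
  have e₁ := LaplacianDelaunay.delaunayPolytope_eq_iUnion_simplex h₁
  have e₂ := LaplacianDelaunay.delaunayPolytope_eq_iUnion_simplex h₂
  refine ⟨e₁, e₂, ?_⟩
  rw [e₁, e₂]
  exact ⟨LaplacianDelaunay.isomorphic_of_congruent h₁ h₂,
    LaplacianDelaunay.congruent_of_isomorphic⟩
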